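/- Let $N$ be a natural number, let $\delta\in\left(-\frac{2}{3\sqrt3},\frac{2}{3\sqrt3}\right)$, and let $z_1(\delta)<-\frac1{\sqrt3}<z_2(\delta)<\frac1{\sqrt3}<z_3(\delta)$ be the three real roots of the polynomial $f_\delta(t)=t-t^3-\delta$. Let $u\in L^3_{\mathrm{loc}}(\mathbb R^N)$ be a real-valued distributional solution of $$-\Delta u=u-u^3-\delta\quad\text{in }\mathbb R^N,$$ that is, $$-\int_{\mathbb R^N}u\,\Delta\varphi\,dx=\int_{\mathbb R^N}(u-u^3-\delta)\,\varphi\,dx\qquad\text{for every }\varphi\in C_c^\infty(\mathbb R^N).$$ Then $z_1(\delta)\le u(x)\le z_3(\delta)$ for almost every $x\in\mathbb R^N$. -/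

import Mathlib

open MeasureTheory Set
open scoped ContDiff Laplacian

/-- The nonlinearity `f_δ(t) = t - t³ - δ`. -/
def cahnHilliardNonlinearity (δ t : ℝ) : ℝ := t - t ^ 3 - δ

/-- The set of real roots of `f_δ`. -/
def rootSetCH (δ : ℝ) : Set ℝ := {t : ℝ | cahnHilliardNonlinearity δ t = 0}

/-- `z₁(δ)`, the smallest real root of `f_δ`. -/
noncomputable def z₁ (δ : ℝ) : ℝ := sInf (rootSetCH δ)

/-- `z₃(δ)`, the largest real root of `f_δ`. -/
noncomputable def z₃ (δ : ℝ) : ℝ := sSup (rootSetCH δ)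

/-- `u ∈ L^p_loc(ℝ^N)`: `u` is in `L^p(K)` for every compact `K`. -/
def MemLpLoc {N : ℕ} (u : EuclideanSpace ℝ (Fin N) → ℝ) (p : ENNReal) : Prop :=
  ∀ K : Set (EuclideanSpace ℝ (Fin N)), IsCompact K → MemLp u p (volume.restrict K)

/-- `u` solves `-Δu = u - u³ - δ` in `𝓓'(ℝ^N)`. For `u ∈ L³_loc(ℝ^N)` both integrands are
integrable for every test function `φ ∈ C_c^∞(ℝ^N)`. -/
def IsDistributionalSolution {N : ℕ} (δ : ℝ) (u : EuclideanSpace ℝ (Fin N) → ℝ) : Prop :=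
  ∀ φ : EuclideanSpace ℝ (Fin N) → ℝ, ContDiff ℝ ∞ φ → HasCompactSupport φ →
    - ∫ x, u x * (Δ φ) x = ∫ x, cahnHilliardNonlinearity δ (u x) * φ x

/-- For `|δ| < 2/(3√3)` the function `f_δ` has exactly three real roots, separated by `±1/√3`;
the outer two are `z₁ δ` and `z₃ δ`. -/
theorem roots_cahnHilliard (δ : ℝ) (hδ : δ ∈ Ioo (-(2 / (3 * √3))) (2 / (3 * √3))) :
    ∃ z₂ : ℝ, z₁ δ < -(1 / √3) ∧ -(1 / √3) < z₂ ∧ z₂ < 1 / √3 ∧ 1 / √3 < z₃ δ ∧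
      rootSetCH δ = {z₁ δ, z₂, z₃ δ} := by
  obtain ⟨h1, h2⟩ := hδ
  have h3 : (0 : ℝ) < √3 := by positivity
  have hsq : √3 ^ 2 = 3 := Real.sq_sqrt (by norm_num)
  set s : ℝ := 1 / √3 with hs
  have hs0 : 0 < s := by positivity
  have hs2 : s ^ 2 = 1 / 3 := by rw [hs, div_pow, hsq]; norm_num
  have hs3 : 2 / (3 * √3) = 2 / 3 * s := by rw [hs]; field_simp
  have hs1 : s < 1 := by nlinarith
  rw [hs3] at h1 h2
  have hc : Continuous (cahnHilliardNonlinearity δ) := by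
    unfold cahnHilliardNonlinearity; fun_prop
  have e1 : 0 < cahnHilliardNonlinearity δ (-2) := by
    unfold cahnHilliardNonlinearity; linarith
  have e2 : cahnHilliardNonlinearity δ (-s) < 0 := by
    unfold cahnHilliardNonlinearity; nlinarith
  have e3 : 0 < cahnHilliardNonlinearity δ s := by
    unfold cahnHilliardNonlinearity; nlinarith
  have e4 : cahnHilliardNonlinearity δ 2 < 0 := by
    unfold cahnHilliardNonlinearity; linarith
  obtain ⟨a, ⟨-, ha⟩, fa⟩ :=
    intermediate_value_Ioo' (by linarith : (-2 : ℝ) ≤ -s) hc.continuousOn ⟨e2, e1⟩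
  obtain ⟨b, ⟨hb, hb'⟩, fb⟩ :=
    intermediate_value_Ioo (by linarith : -s ≤ s) hc.continuousOn ⟨e2, e3⟩
  obtain ⟨c, ⟨hc', -⟩, fc⟩ :=
    intermediate_value_Ioo' (by linarith : s ≤ (2 : ℝ)) hc.continuousOn ⟨e4, e3⟩
  have key : rootSetCH δ = {a, b, c} := by
    have q : ∀ x y : ℝ, cahnHilliardNonlinearity δ x = 0 → cahnHilliardNonlinearity δ y = 0 →
        x ≠ y → x ^ 2 + x * y + y ^ 2 = 1 := by
      intro x y hx hy hxy
      unfold cahnHilliardNonlinearity at hx hy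
      apply mul_left_cancel₀ (sub_ne_zero.2 hxy)
      linarith
    have hab := q a b fa fb (by linarith)
    have hac := q a c fa fc (by linarith)
    have hsum : a + b + c = 0 := by
      apply mul_left_cancel₀ (sub_ne_zero.2 (show b ≠ c by linarith))
      linarith
    ext t
    simp only [rootSetCH, mem_ofPred_eq, mem_insert_iff, mem_singleton_iff]
    constructor
    · intro ft
      by_contra! hne
      have hta := q t a ft fa hne.1
      have htb := q t b ft fb hne.2.1
      have : t + a + b = 0 := by
        apply mul_left_cancel₀ (sub_ne_zero.2 (show a ≠ b by linarith))
        linarith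
      exact hne.2.2 (by linarith)
    · rintro (rfl | rfl | rfl) <;> assumption
  have hz1 : z₁ δ = a := by
    rw [z₁, key]
    refine IsLeast.csInf_eq ⟨by simp, ?_⟩
    rintro x (rfl | rfl | rfl) <;> linarith
  have hz3 : z₃ δ = c := by
    rw [z₃, key]
    refine IsGreatest.csSup_eq ⟨by simp, ?_⟩
    rintro x (rfl | rfl | rfl) <;> linarith
  exact ⟨b, by rw [hz1]; exact ha, hb, hb', by rw [hz3]; exact hc', by rw [hz1, hz3]; exact key⟩

/-!
Rewrite the equation as `Δu = -f_δ(u)`. Since `z = z₃(δ)` is the largest root of the cubic,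
`-f_δ(t) ≥ c (t - z)³` for `t ≥ z` and some `c > 0`. Kato's inequality for a convex `C²` function
`Φ` of slope at most one, vanishing on `(-∞, 0]` and positive on `(0, ∞)`, turns this into
`Δv ≥ c v³` in the sense of distributions for `v = Φ(u - z) ≥ 0`. Mollification preserves this
inequality by convexity of the cube, so `v` may be taken smooth. At an interior maximum of
`v · (R² - |x - y|²)` on the ball of radius `R` around `y`, the inequality forces
`c v(y)² R² ≤ 2N + 8`, and `R → ∞` gives `v = 0`, that is `u ≤ z₃(δ)`. The lower bound follows by
applying this to `-u`, which solves the equation with `-δ`, since `z₃(-δ) = -z₁(δ)`.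
-/

section

open Filter Topology InnerProductSpace Module
open scoped Convolution

section DirectionalDerivatives

variable {E : Type*} [NormedAddCommGroup E] [NormedSpace ℝ E]

/-- The iterated directional derivative `∂ₑ∂ₑf (x)`, in terms of which the Laplacian is computed
one direction at a time. -/
noncomputable def secondDirDeriv (f : E → ℝ) (e x : E) : ℝ :=
  fderiv ℝ (fun y => fderiv ℝ f y e) x e

theorem contDiff_one_fderiv_apply {f : E → ℝ} (hf : ContDiff ℝ 2 f) (e : E) :
    ContDiff ℝ 1 fun y => fderiv ℝ f y e :=
  (hf.fderiv_right (by norm_num)).clm_apply contDiff_const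

theorem continuous_secondDirDeriv {f : E → ℝ} (hf : ContDiff ℝ 2 f) (e : E) :
    Continuous (secondDirDeriv f e) :=
  ((contDiff_one_fderiv_apply hf e).continuous_fderiv one_ne_zero).clm_apply continuous_const

theorem hasCompactSupport_secondDirDeriv {f : E → ℝ} (hf : HasCompactSupport f) (e : E) :
    HasCompactSupport (secondDirDeriv f e) :=
  (hf.fderiv_apply ℝ e).fderiv_apply ℝ e

theorem secondDirDeriv_mul {f g : E → ℝ} (hf : ContDiff ℝ 2 f) (hg : ContDiff ℝ 2 g) (e x : E) :
    secondDirDeriv (fun y => f y * g y) e x =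
      secondDirDeriv f e x * g x + 2 * (fderiv ℝ f x e * fderiv ℝ g x e)
        + f x * secondDirDeriv g e x := by
  have hf' := hf.differentiable two_ne_zero
  have hg' := hg.differentiable two_ne_zero
  have hf'' := (contDiff_one_fderiv_apply hf e).differentiable one_ne_zero
  have hg'' := (contDiff_one_fderiv_apply hg e).differentiable one_ne_zero
  have hfirst : (fun y => fderiv ℝ (fun y => f y * g y) y e) =
      fun y => f y * fderiv ℝ g y e + g y * fderiv ℝ f y e := by
    funext y
    simp [fderiv_fun_mul (hf' y) (hg' y)]
  rw [secondDirDeriv, hfirst, fderiv_fun_add ((hf' x).fun_mul (hg'' x))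
      ((hg' x).fun_mul (hf'' x)),
    fderiv_fun_mul (hf' x) (hg'' x), fderiv_fun_mul (hg' x) (hf'' x)]
  simp only [add_apply, smul_apply, smul_eq_mul, secondDirDeriv]
  ring

theorem secondDirDeriv_comp {Φ : ℝ → ℝ} {f : E → ℝ} (hΦ : ContDiff ℝ 2 Φ) (hf : ContDiff ℝ 2 f)
    (e x : E) :
    secondDirDeriv (fun y => Φ (f y)) e x =
      deriv Φ (f x) * secondDirDeriv f e x + deriv (deriv Φ) (f x) * fderiv ℝ f x e ^ 2 := by
  have hf' := hf.differentiable two_ne_zero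
  have hf'' := (contDiff_one_fderiv_apply hf e).differentiable one_ne_zero
  have hchain : ∀ {Ψ : ℝ → ℝ}, Differentiable ℝ Ψ → ∀ y,
      HasFDerivAt (fun y => Ψ (f y)) (deriv Ψ (f y) • fderiv ℝ f y) y := fun hΨ y =>
    (hΨ (f y)).hasDerivAt.comp_hasFDerivAt y (hf' y).hasFDerivAt
  have hfirst : (fun y => fderiv ℝ (fun y => Φ (f y)) y e) =
      fun y => deriv Φ (f y) * fderiv ℝ f y e := by
    funext y
    simp [(hchain (hΦ.differentiable two_ne_zero) y).fderiv]
  have hΦ' : Differentiable ℝ (deriv Φ) := hΦ.differentiable_deriv_two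
  rw [secondDirDeriv, hfirst, ((hchain hΦ' x).fun_mul (hf'' x).hasFDerivAt).fderiv]
  simp only [add_apply, smul_apply, smul_eq_mul, secondDirDeriv]
  ring

theorem fderiv_comp_const_sub_apply {f : E → ℝ} (hf : Differentiable ℝ f) (x y e : E) :
    fderiv ℝ (fun t => f (x - t)) y e = -fderiv ℝ f (x - y) e := by
  have h := (hf (x - y)).hasFDerivAt.comp y ((hasFDerivAt_id y).const_sub x)
  simpa [Function.comp_def] using congrArg (· e) h.fderiv

theorem secondDirDeriv_comp_const_sub {f : E → ℝ} (hf : ContDiff ℝ 2 f) (x y e : E) :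
    secondDirDeriv (fun t => f (x - t)) e y = secondDirDeriv f e (x - y) := by
  simp_rw [secondDirDeriv, fderiv_comp_const_sub_apply (hf.differentiable two_ne_zero)]
  rw [fderiv_fun_neg, neg_apply, neg_eq_iff_eq_neg]
  exact fderiv_comp_const_sub_apply
    ((contDiff_one_fderiv_apply hf e).differentiable one_ne_zero) x y e

theorem deriv_deriv_nonpos_of_isLocalMax {f : ℝ → ℝ} {a : ℝ} (h : IsLocalMax f a)
    (hc : ContinuousAt f a) : deriv (deriv f) a ≤ 0 := by
  by_contra! hpos
  have hmin : IsLocalMin f a := isLocalMin_of_deriv_deriv_pos hpos h.deriv_eq_zero hc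
  have hconst : f =ᶠ[𝓝 a] fun _ => f a := by
    filter_upwards [h, hmin] with x h1 h2 using le_antisymm h1 h2
  simp [hconst.deriv.deriv_eq] at hpos

theorem secondDirDeriv_nonpos_of_isLocalMax {f : E → ℝ} (hf : ContDiff ℝ 2 f) {x : E}
    (h : IsLocalMax f x) (e : E) : secondDirDeriv f e x ≤ 0 := by
  have hline : ∀ {g : E → ℝ}, Differentiable ℝ g → ∀ t : ℝ,
      HasDerivAt (fun t : ℝ => g (x + t • e)) (fderiv ℝ g (x + t • e) e) t := fun hg t =>
    (hg _).hasFDerivAt.comp_hasDerivAt t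
      (by simpa using ((hasDerivAt_id t).smul_const e).const_add x)
  have hderiv : deriv (fun t : ℝ => f (x + t • e)) = fun t => fderiv ℝ f (x + t • e) e :=
    funext fun t => (hline (hf.differentiable two_ne_zero) t).deriv
  have hderiv₂ : deriv (deriv fun t : ℝ => f (x + t • e)) 0 = secondDirDeriv f e x := by
    rw [hderiv, (hline ((contDiff_one_fderiv_apply hf e).differentiable one_ne_zero) 0).deriv]
    simp [secondDirDeriv]
  have hcont : Continuous fun t : ℝ => x + t • e := by fun_prop
  rw [← hderiv₂]
  refine deriv_deriv_nonpos_of_isLocalMax ?_ (hf.continuous.comp hcont).continuousAt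
  exact IsLocalMax.comp_continuous (by simpa using h) hcont.continuousAt

end DirectionalDerivatives

section Laplacian

theorem integrable_mul_of_hasCompactSupport {X : Type*} [TopologicalSpace X] [T2Space X]
    [MeasurableSpace X] [OpensMeasurableSpace X] {μ : Measure X} {f g : X → ℝ}
    (hf : LocallyIntegrable f μ) (hg : Continuous g) (hgc : HasCompactSupport g) :
    Integrable (fun x => f x * g x) μ := by
  simpa only [smul_eq_mul, mul_comm] using hf.integrable_smul_left_of_hasCompactSupport hg hgc

variable {E : Type*} [NormedAddCommGroup E] [InnerProductSpace ℝ E] [FiniteDimensional ℝ E]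

theorem laplacian_eq_sum_secondDirDeriv {f : E → ℝ} (hf : ContDiff ℝ 2 f) (x : E) :
    (Δ f) x = ∑ i, secondDirDeriv f (stdOrthonormalBasis ℝ E i) x := by
  have hd : DifferentiableAt ℝ (fderiv ℝ f) x :=
    (hf.fderiv_right (m := 1) (by norm_num)).differentiable one_ne_zero x
  simp_rw [laplacian_eq_iteratedFDeriv_stdOrthonormalBasis, iteratedFDeriv_two_apply,
    secondDirDeriv, fderiv_clm_apply hd (differentiableAt_const _)]
  simp

theorem continuous_laplacian {f : E → ℝ} (hf : ContDiff ℝ 2 f) : Continuous (Δ f) := by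
  simp_rw [funext (laplacian_eq_sum_secondDirDeriv hf)]
  exact continuous_finsetSum _ fun i _ => continuous_secondDirDeriv hf _

theorem hasCompactSupport_laplacian {f : E → ℝ} (hf : HasCompactSupport f) :
    HasCompactSupport (Δ f) := by
  refine hf.mono' fun x hx => ?_
  contrapose! hx
  have hzero : f =ᶠ[𝓝 x] fun _ => (0 : ℝ) := notMem_tsupport_iff_eventuallyEq.1 hx
  simpa using (laplacian_congr_nhds hzero).eq_of_nhds

theorem deriv_mul_laplacian_le_laplacian_comp {Φ : ℝ → ℝ} {f : E → ℝ} (hΦ : ContDiff ℝ 2 Φ)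
    (hconv : ConvexOn ℝ univ Φ) (hf : ContDiff ℝ 2 f) (x : E) :
    deriv Φ (f x) * (Δ f) x ≤ (Δ fun y => Φ (f y)) x := by
  have hmono : Monotone (deriv Φ) := monotoneOn_univ.1 <|
    hconv.monotoneOn_deriv fun t _ => hΦ.differentiable two_ne_zero t
  have hcomp : ContDiff ℝ 2 fun y => Φ (f y) := hΦ.comp hf
  rw [laplacian_eq_sum_secondDirDeriv hf, laplacian_eq_sum_secondDirDeriv hcomp, Finset.mul_sum]
  refine Finset.sum_le_sum fun i _ => ?_
  rw [secondDirDeriv_comp hΦ hf]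
  exact le_add_of_nonneg_right (mul_nonneg hmono.deriv_nonneg (sq_nonneg _))

theorem laplacian_comp_const_sub {f : E → ℝ} (hf : ContDiff ℝ 2 f) (x y : E) :
    (Δ fun t => f (x - t)) y = (Δ f) (x - y) := by
  have hcomp : ContDiff ℝ 2 fun t => f (x - t) := hf.comp (contDiff_const.sub contDiff_id)
  rw [laplacian_eq_sum_secondDirDeriv hf, laplacian_eq_sum_secondDirDeriv hcomp]
  exact Finset.sum_congr rfl fun i _ => secondDirDeriv_comp_const_sub hf x y _

variable [MeasurableSpace E] [BorelSpace E] {μ : Measure E} [μ.IsAddHaarMeasure]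

theorem integral_mul_fderiv_apply {f g : E → ℝ} (hf : ContDiff ℝ 1 f) (hg : ContDiff ℝ 1 g)
    (hgc : HasCompactSupport g) (e : E) :
    ∫ x, f x * fderiv ℝ g x e ∂μ = -∫ x, fderiv ℝ f x e * g x ∂μ := by
  have hf' := (hf.continuous_fderiv one_ne_zero).clm_apply (continuous_const (y := e))
  have hg' := (hg.continuous_fderiv one_ne_zero).clm_apply (continuous_const (y := e))
  exact integral_mul_fderiv_eq_neg_fderiv_mul_of_integrable
    (integrable_mul_of_hasCompactSupport hf'.locallyIntegrable hg.continuous hgc)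
    (integrable_mul_of_hasCompactSupport hf.continuous.locallyIntegrable hg'
      (hgc.fderiv_apply ℝ e))
    (integrable_mul_of_hasCompactSupport hf.continuous.locallyIntegrable hg.continuous hgc)
    (fun x _ => hf.differentiable one_ne_zero x) (fun x _ => hg.differentiable one_ne_zero x)

theorem integral_mul_secondDirDeriv {f g : E → ℝ} (hf : ContDiff ℝ 2 f) (hg : ContDiff ℝ 2 g)
    (hgc : HasCompactSupport g) (e : E) :
    ∫ x, f x * secondDirDeriv g e x ∂μ = ∫ x, secondDirDeriv f e x * g x ∂μ := by
  have hle : (1 : WithTop ℕ∞) ≤ 2 := one_le_two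
  simp_rw [secondDirDeriv]
  rw [integral_mul_fderiv_apply (hf.of_le hle) (contDiff_one_fderiv_apply hg e)
    (hgc.fderiv_apply ℝ e) e,
    integral_mul_fderiv_apply (contDiff_one_fderiv_apply hf e) (hg.of_le hle) hgc e, neg_neg]

theorem integral_mul_laplacian {f g : E → ℝ} (hf : ContDiff ℝ 2 f) (hg : ContDiff ℝ 2 g)
    (hgc : HasCompactSupport g) : ∫ x, f x * (Δ g) x ∂μ = ∫ x, (Δ f) x * g x ∂μ := by
  simp_rw [laplacian_eq_sum_secondDirDeriv hf, laplacian_eq_sum_secondDirDeriv hg,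
    Finset.mul_sum, Finset.sum_mul]
  rw [integral_finsetSum, integral_finsetSum]
  · exact Finset.sum_congr rfl fun i _ => integral_mul_secondDirDeriv hf hg hgc _
  · exact fun i _ => integrable_mul_of_hasCompactSupport
      (continuous_secondDirDeriv hf _).locallyIntegrable hg.continuous hgc
  · exact fun i _ => integrable_mul_of_hasCompactSupport hf.continuous.locallyIntegrable
      (continuous_secondDirDeriv hg _) (hasCompactSupport_secondDirDeriv hgc _)

theorem fderiv_convolution_apply {f ρ : E → ℝ} (hf : LocallyIntegrable f μ)
    (hρ : ContDiff ℝ 1 ρ) (hρc : HasCompactSupport ρ) (e x : E) :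
    fderiv ℝ (f ⋆[ContinuousLinearMap.lsmul ℝ ℝ, μ] ρ) x e =
      (f ⋆[ContinuousLinearMap.lsmul ℝ ℝ, μ] fun y => fderiv ℝ ρ y e) x := by
  rw [(hρc.hasFDerivAt_convolution_right _ hf hρ x).fderiv]
  exact convolution_precompR_apply _ hf (hρc.fderiv ℝ) (hρ.continuous_fderiv one_ne_zero) x e

theorem secondDirDeriv_convolution {f ρ : E → ℝ} (hf : LocallyIntegrable f μ)
    (hρ : ContDiff ℝ 2 ρ) (hρc : HasCompactSupport ρ) (e x : E) :
    secondDirDeriv (f ⋆[ContinuousLinearMap.lsmul ℝ ℝ, μ] ρ) e x =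
      (f ⋆[ContinuousLinearMap.lsmul ℝ ℝ, μ] secondDirDeriv ρ e) x := by
  simp_rw [secondDirDeriv, fderiv_convolution_apply hf (hρ.of_le one_le_two) hρc]
  exact fderiv_convolution_apply hf (contDiff_one_fderiv_apply hρ e) (hρc.fderiv_apply ℝ e) e x

theorem laplacian_convolution {f ρ : E → ℝ} (hf : LocallyIntegrable f μ) (hρ : ContDiff ℝ 2 ρ)
    (hρc : HasCompactSupport ρ) (x : E) :
    (Δ (f ⋆[ContinuousLinearMap.lsmul ℝ ℝ, μ] ρ)) x =
      (f ⋆[ContinuousLinearMap.lsmul ℝ ℝ, μ] Δ ρ) x := by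
  have hconv : ContDiff ℝ 2 (f ⋆[ContinuousLinearMap.lsmul ℝ ℝ, μ] ρ) :=
    hρc.contDiff_convolution_right (n := 2) _ hf hρ
  simp_rw [laplacian_eq_sum_secondDirDeriv hconv, secondDirDeriv_convolution hf hρ hρc,
    convolution_def, laplacian_eq_sum_secondDirDeriv hρ, map_sum]
  exact (integral_finsetSum _ fun i _ =>
    (hasCompactSupport_secondDirDeriv hρc _).convolutionExists_right _ hf
      (continuous_secondDirDeriv hρ _) x).symm

end Laplacian

section KellerOsserman

variable {E : Type*} [NormedAddCommGroup E] [InnerProductSpace ℝ E]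

theorem contDiff_const_sub_norm_sub_sq (r : ℝ) (y : E) : ContDiff ℝ 2 fun z => r - ‖z - y‖ ^ 2 :=
  contDiff_const.sub ((contDiff_id.sub contDiff_const).norm_sq ℝ)

theorem fderiv_const_sub_norm_sub_sq_apply (r : ℝ) (x y e : E) :
    fderiv ℝ (fun z => r - ‖z - y‖ ^ 2) x e = -2 * ⟪x - y, e⟫_ℝ := by
  simpa [inner_sub_left] using
    congrArg (· e) (((hasFDerivAt_id x).sub_const y).norm_sq.const_sub r).fderiv

theorem secondDirDeriv_const_sub_norm_sub_sq (r : ℝ) (x y e : E) :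
    secondDirDeriv (fun z => r - ‖z - y‖ ^ 2) e x = -2 * ‖e‖ ^ 2 := by
  have h := ((((hasFDerivAt_id x).sub_const y).inner ℝ (hasFDerivAt_const e x)).const_mul
    (-2 : ℝ)).fderiv
  simp_rw [secondDirDeriv, fderiv_const_sub_norm_sub_sq_apply]
  simpa [real_inner_self_eq_norm_sq] using congrArg (· e) h

theorem secondDirDeriv_mul_sq_le_of_isLocalMax {v : E → ℝ} (hv : ContDiff ℝ 2 v) {r : ℝ} {x y : E}
    (hpos : 0 ≤ r - ‖x - y‖ ^ 2) (hmax : IsLocalMax (fun z => v z * (r - ‖z - y‖ ^ 2)) x)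
    {e : E} (he : ‖e‖ = 1) :
    secondDirDeriv v e x * (r - ‖x - y‖ ^ 2) ^ 2 ≤
      v x * (2 * (r - ‖x - y‖ ^ 2) + 8 * ⟪e, x - y⟫_ℝ ^ 2) := by
  have hw := contDiff_const_sub_norm_sub_sq r y
  have hfirst : fderiv ℝ v x e * (r - ‖x - y‖ ^ 2) = 2 * v x * ⟪e, x - y⟫_ℝ := by
    have h := congrArg (· e) hmax.fderiv_eq_zero
    rw [fderiv_fun_mul (hv.differentiable two_ne_zero x) (hw.differentiable two_ne_zero x)] at h
    simp only [add_apply, smul_apply, smul_eq_mul, fderiv_const_sub_norm_sub_sq_apply,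
      zero_apply, real_inner_comm e] at h
    linarith
  have hsecond := secondDirDeriv_nonpos_of_isLocalMax (hv.mul hw) hmax e
  rw [secondDirDeriv_mul hv hw, fderiv_const_sub_norm_sub_sq_apply,
    secondDirDeriv_const_sub_norm_sub_sq, he, real_inner_comm] at hsecond
  linear_combination (r - ‖x - y‖ ^ 2) * hsecond + 4 * ⟪e, x - y⟫_ℝ * hfirst

variable [FiniteDimensional ℝ E]

theorem laplacian_mul_sq_le_of_isLocalMax {v : E → ℝ} (hv : ContDiff ℝ 2 v) {r : ℝ} {x y : E}
    (hpos : 0 ≤ r - ‖x - y‖ ^ 2) (hmax : IsLocalMax (fun z => v z * (r - ‖z - y‖ ^ 2)) x) :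
    (Δ v) x * (r - ‖x - y‖ ^ 2) ^ 2 ≤
      v x * (2 * finrank ℝ E * (r - ‖x - y‖ ^ 2) + 8 * ‖x - y‖ ^ 2) := by
  rw [laplacian_eq_sum_secondDirDeriv hv, Finset.sum_mul]
  refine (Finset.sum_le_sum fun i _ => secondDirDeriv_mul_sq_le_of_isLocalMax hv hpos hmax
    ((stdOrthonormalBasis ℝ E).norm_eq_one i)).trans_eq ?_
  rw [← Finset.mul_sum, Finset.sum_add_distrib, ← Finset.mul_sum (a := (8 : ℝ)),
    OrthonormalBasis.sum_sq_inner_right, Finset.sum_const, Finset.card_univ, Fintype.card_fin,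
    nsmul_eq_mul]
  ring

theorem mul_sq_le_of_isLocalMax {v : E → ℝ} (hv : ContDiff ℝ 2 v) {c r : ℝ} {x y : E}
    (hvx : 0 < v x) (hpos : 0 ≤ r - ‖x - y‖ ^ 2) (hΔ : c * v x ^ 3 ≤ (Δ v) x)
    (hmax : IsLocalMax (fun z => v z * (r - ‖z - y‖ ^ 2)) x) :
    c * (v x * (r - ‖x - y‖ ^ 2)) ^ 2 ≤ (2 * finrank ℝ E + 8) * r := by
  refine le_of_mul_le_mul_left ?_ hvx
  calc v x * (c * (v x * (r - ‖x - y‖ ^ 2)) ^ 2)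
      = c * v x ^ 3 * (r - ‖x - y‖ ^ 2) ^ 2 := by ring
    _ ≤ (Δ v) x * (r - ‖x - y‖ ^ 2) ^ 2 := by gcongr
    _ ≤ v x * (2 * finrank ℝ E * (r - ‖x - y‖ ^ 2) + 8 * ‖x - y‖ ^ 2) :=
      laplacian_mul_sq_le_of_isLocalMax hv hpos hmax
    _ ≤ v x * (2 * finrank ℝ E * r + 8 * r) := by
      gcongr
      · exact sub_le_self _ (sq_nonneg _)
      · exact sub_nonneg.1 hpos
    _ = v x * ((2 * finrank ℝ E + 8) * r) := by ring

theorem mul_sq_mul_sq_le_of_mul_pow_three_le_laplacian {v : E → ℝ} (hv : ContDiff ℝ 2 v)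
    {c R : ℝ} (hc : 0 ≤ c) (hR : 0 < R) {y : E} (hvy : 0 ≤ v y)
    (hΔ : ∀ x ∈ Metric.ball y R, c * v x ^ 3 ≤ (Δ v) x) :
    c * v y ^ 2 * R ^ 2 ≤ 2 * finrank ℝ E + 8 := by
  rcases hvy.eq_or_lt with hvy | hvy
  · simpa [← hvy] using (by positivity : (0 : ℝ) ≤ 2 * finrank ℝ E + 8)
  have hcont : Continuous fun z => v z * (R ^ 2 - ‖z - y‖ ^ 2) :=
    hv.continuous.mul (contDiff_const_sub_norm_sub_sq (R ^ 2) y).continuous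
  obtain ⟨x, hx, hmax⟩ := (isCompact_closedBall y R).exists_isMaxOn
    ⟨y, Metric.mem_closedBall_self hR.le⟩ hcont.continuousOn
  have hle : v y * R ^ 2 ≤ v x * (R ^ 2 - ‖x - y‖ ^ 2) := by
    simpa using hmax (Metric.mem_closedBall_self hR.le)
  have hweight : 0 ≤ R ^ 2 - ‖x - y‖ ^ 2 := by
    rw [mem_closedBall_iff_norm] at hx
    exact sub_nonneg.2 (pow_le_pow_left₀ (norm_nonneg _) hx 2)
  have hprod : 0 < v x * (R ^ 2 - ‖x - y‖ ^ 2) := lt_of_lt_of_le (by positivity) hle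
  have hball : x ∈ Metric.ball y R := by
    rw [mem_ball_iff_norm]
    exact lt_of_pow_lt_pow_left₀ 2 hR.le
      (sub_pos.1 (hweight.lt_of_ne' (right_ne_zero_of_mul hprod.ne')))
  have hloc : IsLocalMax (fun z => v z * (R ^ 2 - ‖z - y‖ ^ 2)) x :=
    hmax.isLocalMax (mem_of_superset (Metric.isOpen_ball.mem_nhds hball)
      Metric.ball_subset_closedBall)
  refine le_of_mul_le_mul_right ?_ (pow_pos hR 2)
  calc c * v y ^ 2 * R ^ 2 * R ^ 2 = c * (v y * R ^ 2) ^ 2 := by ring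
    _ ≤ c * (v x * (R ^ 2 - ‖x - y‖ ^ 2)) ^ 2 := by gcongr
    _ ≤ (2 * finrank ℝ E + 8) * R ^ 2 :=
      mul_sq_le_of_isLocalMax hv (pos_of_mul_pos_left hprod hweight) hweight (hΔ x hball) hloc

theorem eq_zero_of_mul_pow_three_le_laplacian {v : E → ℝ} (hv : ContDiff ℝ 2 v) {c : ℝ}
    (hc : 0 < c) {y : E} (hvy : 0 ≤ v y) (hΔ : ∀ x, c * v x ^ 3 ≤ (Δ v) x) : v y = 0 := by
  by_contra hne
  have hpos : 0 < c * v y ^ 2 := by positivity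
  obtain ⟨R, hlt, hR⟩ := (((tendsto_pow_atTop two_ne_zero).const_mul_atTop hpos).eventually_gt_atTop
    (2 * finrank ℝ E + 8 : ℝ)).and (eventually_gt_atTop 0) |>.exists
  exact hlt.not_ge
    (mul_sq_mul_sq_le_of_mul_pow_three_le_laplacian hv hc.le hR hvy fun x _ => hΔ x)

end KellerOsserman

section LocalConvergence

variable {X : Type*} [TopologicalSpace X] [MeasurableSpace X] {μ : Measure X}

theorem locallyIntegrable_mul_of_norm_le {b f : X → ℝ} {C : ℝ} (hf : LocallyIntegrable f μ)
    (hb : AEStronglyMeasurable b μ) (hbC : ∀ᵐ x ∂μ, ‖b x‖ ≤ C) :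
    LocallyIntegrable (fun x => b x * f x) μ := fun x => by
  obtain ⟨s, hs, hint⟩ := hf x
  exact ⟨s, hs, Integrable.bdd_mul hint hb.restrict (ae_restrict_of_ae hbC)⟩

theorem locallyIntegrable_comp_of_lipschitzWith [IsLocallyFiniteMeasure μ]
    [SecondCountableTopology X] {Φ : ℝ → ℝ} {K : NNReal} (hΦ : LipschitzWith K Φ) {f : X → ℝ}
    (hf : LocallyIntegrable f μ) : LocallyIntegrable (fun x => Φ (f x)) μ := by
  have hsub : LocallyIntegrable (fun x => Φ (f x) - Φ 0) μ :=
    (hf.smul (K : ℝ)).mono ((hΦ.continuous.comp_aestronglyMeasurable hf.aestronglyMeasurable).sub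
      aestronglyMeasurable_const) (.of_forall fun x => by simpa using hΦ.norm_sub_le (f x) 0)
  simpa only [Pi.add_def, sub_add_cancel] using hsub.add (locallyIntegrable_const (Φ 0))

/-- Convergence in `L¹_loc` of a sequence of locally integrable functions, tested on compact
sets. -/
structure TendstoInL1Loc (f : ℕ → X → ℝ) (g : X → ℝ) (μ : Measure X) : Prop where
  locallyIntegrable : ∀ n, LocallyIntegrable (f n) μ
  locallyIntegrable_limit : LocallyIntegrable g μ
  tendsto : ∀ K, IsCompact K → Tendsto (fun n => ∫ x in K, ‖f n x - g x‖ ∂μ) atTop (𝓝 0)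

namespace TendstoInL1Loc

variable {f : ℕ → X → ℝ} {g : X → ℝ}

theorem integrableOn_sub (h : TendstoInL1Loc f g μ) (n : ℕ) {K : Set X} (hK : IsCompact K) :
    IntegrableOn (fun x => f n x - g x) K μ :=
  ((h.locallyIntegrable n).sub h.locallyIntegrable_limit).integrableOn_isCompact hK

theorem lipschitzWith_comp [SecondCountableTopology X] [IsLocallyFiniteMeasure μ]
    (h : TendstoInL1Loc f g μ) {Φ : ℝ → ℝ} {C : NNReal} (hΦ : LipschitzWith C Φ) :
    TendstoInL1Loc (fun n x => Φ (f n x)) (fun x => Φ (g x)) μ where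
  locallyIntegrable n := locallyIntegrable_comp_of_lipschitzWith hΦ (h.locallyIntegrable n)
  locallyIntegrable_limit := locallyIntegrable_comp_of_lipschitzWith hΦ h.locallyIntegrable_limit
  tendsto K hK := by
    refine squeeze_zero (fun n => integral_nonneg fun x => norm_nonneg _) (fun n => ?_)
      (by simpa using (h.tendsto K hK).const_mul (C : ℝ))
    rw [← integral_const_mul]
    exact integral_mono_of_nonneg (.of_forall fun x => norm_nonneg _)
      ((h.integrableOn_sub n hK).norm.const_mul _) (.of_forall fun x => hΦ.norm_sub_le _ _)

theorem bdd_mul (h : TendstoInL1Loc f g μ) {b : ℕ → X → ℝ} {b' : X → ℝ} {C : ℝ}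
    (hb : ∀ n, AEStronglyMeasurable (b n) μ) (hbC : ∀ n x, ‖b n x‖ ≤ C)
    (hlim : ∀ᵐ x ∂μ, Tendsto (fun n => b n x) atTop (𝓝 (b' x))) :
    TendstoInL1Loc (fun n x => b n x * f n x) (fun x => b' x * g x) μ := by
  have hb' : AEStronglyMeasurable b' μ := aestronglyMeasurable_of_tendsto_ae atTop hb hlim
  have hbC' : ∀ᵐ x ∂μ, ‖b' x‖ ≤ C := by
    filter_upwards [hlim] with x hx using le_of_tendsto' hx.norm fun n => hbC n x
  refine ⟨fun n => locallyIntegrable_mul_of_norm_le (h.locallyIntegrable n) (hb n)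
    (.of_forall (hbC n)), locallyIntegrable_mul_of_norm_le h.locallyIntegrable_limit hb' hbC',
    fun K hK => ?_⟩
  have hg : IntegrableOn g K μ := h.locallyIntegrable_limit.integrableOn_isCompact hK
  have hbg : ∀ n, IntegrableOn (fun x => (b n x - b' x) * g x) K μ := fun n =>
    Integrable.bdd_mul (c := C + C) hg ((hb n).sub hb').restrict <| ae_restrict_of_ae <| by
      filter_upwards [hbC'] with x hx using norm_sub_le_of_le (hbC n x) hx
  have hmult : Tendsto (fun n => ∫ x in K, ‖(b n x - b' x) * g x‖ ∂μ) atTop (𝓝 0) := by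
    rw [← integral_zero X ℝ (μ := μ.restrict K)]
    refine tendsto_integral_of_dominated_convergence (fun x => (C + C) * ‖g x‖)
      (fun n => (hbg n).norm.1) (hg.norm.const_mul _) (fun n => ae_restrict_of_ae ?_)
      (ae_restrict_of_ae ?_)
    · filter_upwards [hbC'] with x hx
      rw [norm_norm, norm_mul]
      gcongr
      exact norm_sub_le_of_le (hbC n x) hx
    · filter_upwards [hlim] with x hx
      simpa using ((hx.sub_const (b' x)).mul_const (g x)).norm
  refine squeeze_zero (fun n => integral_nonneg fun x => norm_nonneg _) (fun n => ?_)
    (by simpa only [mul_zero, add_zero] using ((h.tendsto K hK).const_mul C).add hmult)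
  have hfg := (h.integrableOn_sub n hK).norm.const_mul C
  rw [← integral_const_mul, ← integral_add hfg (hbg n).norm]
  refine integral_mono_of_nonneg (.of_forall fun x => norm_nonneg _) (hfg.add (hbg n).norm)
    (.of_forall fun x => ?_)
  calc ‖b n x * f n x - b' x * g x‖ = ‖b n x * (f n x - g x) + (b n x - b' x) * g x‖ := by
        congr 1; ring
    _ ≤ ‖b n x‖ * ‖f n x - g x‖ + ‖(b n x - b' x) * g x‖ := by
        rw [← norm_mul]; exact norm_add_le _ _
    _ ≤ C * ‖f n x - g x‖ + ‖(b n x - b' x) * g x‖ := by gcongr; exact hbC n x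

theorem tendsto_integral_mul [T2Space X] [OpensMeasurableSpace X] (h : TendstoInL1Loc f g μ)
    {ψ : X → ℝ} (hψ : Continuous ψ) (hψc : HasCompactSupport ψ) :
    Tendsto (fun n => ∫ x, f n x * ψ x ∂μ) atTop (𝓝 (∫ x, g x * ψ x ∂μ)) := by
  obtain ⟨C, hC⟩ := hψ.bounded_above_of_compact_support hψc
  refine tendsto_iff_norm_sub_tendsto_zero.2 <| squeeze_zero (fun n => norm_nonneg _) (fun n => ?_)
    (by simpa using (h.tendsto _ hψc.isCompact).const_mul C)
  calc ‖∫ x, f n x * ψ x ∂μ - ∫ x, g x * ψ x ∂μ‖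
      = ‖∫ x in tsupport ψ, (f n x - g x) * ψ x ∂μ‖ := by
        rw [setIntegral_eq_integral_of_forall_compl_eq_zero fun x hx => by
          rw [image_eq_zero_of_notMem_tsupport hx, mul_zero], ← integral_sub
          (integrable_mul_of_hasCompactSupport (h.locallyIntegrable n) hψ hψc)
          (integrable_mul_of_hasCompactSupport h.locallyIntegrable_limit hψ hψc)]
        simp_rw [sub_mul]
    _ ≤ ∫ x in tsupport ψ, C * ‖f n x - g x‖ ∂μ := by
        refine norm_integral_le_of_norm_le ((h.integrableOn_sub n hψc).norm.const_mul C)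
          (.of_forall fun x => ?_)
        rw [norm_mul, mul_comm]
        gcongr
        exact hC x
    _ = C * ∫ x in tsupport ψ, ‖f n x - g x‖ ∂μ := integral_const_mul _ _

end TendstoInL1Loc

end LocalConvergence

section Mollification

theorem tendsto_integral_norm_sub_of_integral_norm_le {α ι F : Type*} [MeasurableSpace α]
    {μ : Measure α} [NormedAddCommGroup F] {l : Filter ι} [l.IsCountablyGenerated]
    {f : ι → α → F} {g : α → F} (hf : ∀ i, Integrable (f i) μ) (hg : Integrable g μ)
    (hlim : ∀ᵐ x ∂μ, Tendsto (fun i => f i x) l (𝓝 (g x)))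
    (hle : ∀ i, ∫ x, ‖f i x‖ ∂μ ≤ ∫ x, ‖g x‖ ∂μ) :
    Tendsto (fun i => ∫ x, ‖f i x - g x‖ ∂μ) l (𝓝 0) := by
  -- The deficit in the triangle inequality is dominated by `2‖g‖`.
  have hdeficit : Tendsto (fun i => ∫ x, (‖g x‖ + ‖f i x‖ - ‖f i x - g x‖) ∂μ) l
      (𝓝 (∫ x, (‖g x‖ + ‖g x‖) ∂μ)) := by
    refine tendsto_integral_filter_of_dominated_convergence (fun x => ‖g x‖ + ‖g x‖)
      (.of_forall fun i => ((hg.norm.add (hf i).norm).sub ((hf i).sub hg).norm).1)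
      (.of_forall fun i => .of_forall fun x => ?_) (hg.norm.add hg.norm) ?_
    · rw [Real.norm_of_nonneg (by linarith [norm_sub_le (f i x) (g x)])]
      linarith [norm_sub_norm_le (f i x) (g x)]
    · filter_upwards [hlim] with x hx
      simpa using (tendsto_const_nhds.add hx.norm).sub (hx.sub_const (g x)).norm
  have hbound : ∀ i, ∫ x, ‖f i x - g x‖ ∂μ ≤
      ∫ x, (‖g x‖ + ‖g x‖) ∂μ - ∫ x, (‖g x‖ + ‖f i x‖ - ‖f i x - g x‖) ∂μ := fun i => by
    have hdiff : Integrable (fun x => ‖f i x - g x‖) μ := ((hf i).sub hg).norm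
    rw [integral_sub (f := fun x => ‖g x‖ + ‖f i x‖) (hg.norm.add (hf i).norm) hdiff,
      integral_add hg.norm (hf i).norm, integral_add hg.norm hg.norm]
    linarith [hle i]
  refine squeeze_zero (fun i => integral_nonneg fun x => norm_nonneg _) hbound ?_
  simpa only [sub_self] using hdeficit.const_sub (∫ x, (‖g x‖ + ‖g x‖) ∂μ)

variable {E : Type*} [NormedAddCommGroup E] [InnerProductSpace ℝ E] [FiniteDimensional ℝ E]
  [MeasurableSpace E]

/-- The mollification of `g` with the bump function `φ`, normalized to have integral one. -/
noncomputable def mollify (φ : ContDiffBump (0 : E)) (μ : Measure E) (g : E → ℝ) : E → ℝ :=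
  g ⋆[ContinuousLinearMap.lsmul ℝ ℝ, μ] φ.normed μ

variable {μ : Measure E} (φ : ContDiffBump (0 : E)) {g : E → ℝ}

theorem mollify_apply (g : E → ℝ) (x : E) :
    mollify φ μ g x = ∫ t, g t * φ.normed μ (x - t) ∂μ := rfl

theorem mollify_nonneg (hg : ∀ x, 0 ≤ g x) (x : E) : 0 ≤ mollify φ μ g x :=
  integral_nonneg fun t => mul_nonneg (hg t) (φ.nonneg_normed _)

theorem norm_mollify_le (g : E → ℝ) (x : E) :
    ‖mollify φ μ g x‖ ≤ mollify φ μ (fun t => ‖g t‖) x := by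
  refine (norm_integral_le_integral_norm _).trans_eq (integral_congr_ae (.of_forall fun t => ?_))
  simp [abs_of_nonneg (φ.nonneg_normed (μ := μ) (x - t))]

variable [BorelSpace E] [μ.IsAddHaarMeasure]

theorem mollify_congr {h : E → ℝ} {x : E} (hgh : EqOn g h (Metric.ball x φ.rOut)) :
    mollify φ μ g x = mollify φ μ h x := by
  simp only [mollify_apply]
  refine integral_congr_ae (.of_forall fun t => ?_)
  by_cases ht : t ∈ Metric.ball x φ.rOut
  · simp only [hgh ht]
  · have hzero : φ.normed μ (x - t) = 0 := by
      rwa [← Function.notMem_support, φ.support_normed_eq, mem_ball_zero_iff, norm_sub_rev,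
        ← mem_ball_iff_norm]
    simp only [hzero, mul_zero]

theorem integrable_mul_normed_sub (hg : LocallyIntegrable g μ) (x : E) :
    Integrable (fun t => g t * φ.normed μ (x - t)) μ :=
  φ.hasCompactSupport_normed.convolutionExists_right (ContinuousLinearMap.lsmul ℝ ℝ) hg
    φ.continuous_normed x

theorem contDiff_mollify (hg : LocallyIntegrable g μ) : ContDiff ℝ 2 (mollify φ μ g) :=
  φ.hasCompactSupport_normed.contDiff_convolution_right (n := 2) _ hg φ.contDiff_normed

theorem integrable_mollify (hg : Integrable g μ) : Integrable (mollify φ μ g) μ :=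
  hg.integrable_convolution _ φ.integrable_normed

theorem integral_mollify (hg : Integrable g μ) : ∫ x, mollify φ μ g x ∂μ = ∫ x, g x ∂μ := by
  rw [mollify, integral_convolution _ hg φ.integrable_normed, φ.integral_normed]
  simp

theorem integral_norm_mollify_le (hg : Integrable g μ) :
    ∫ x, ‖mollify φ μ g x‖ ∂μ ≤ ∫ x, ‖g x‖ ∂μ :=
  (integral_mono (integrable_mollify φ hg).norm (integrable_mollify φ hg.norm)
    (norm_mollify_le φ g)).trans_eq (integral_mollify φ hg.norm)

theorem integral_normed_sub (x : E) : ∫ t, φ.normed μ (x - t) ∂μ = 1 := by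
  rw [integral_sub_left_eq_self (φ.normed μ) μ x, φ.integral_normed]

theorem mollify_pow_three_le (h0 : ∀ x, 0 ≤ g x) (hg : LocallyIntegrable g μ)
    (hg3 : LocallyIntegrable (fun x => g x ^ 3) μ) (x : E) :
    mollify φ μ g x ^ 3 ≤ mollify φ μ (fun t => g t ^ 3) x := by
  set b := mollify φ μ g x
  have hb : 0 ≤ b := mollify_nonneg φ h0 x
  have hg' := (integrable_mul_normed_sub φ hg x).const_mul (3 * b ^ 2)
  have hk : Integrable (fun t => 2 * b ^ 3 * φ.normed μ (x - t)) μ :=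
    (φ.integrable_normed.comp_sub_left x).const_mul _
  calc b ^ 3 = 3 * b ^ 2 * b - 2 * b ^ 3 * 1 := by ring
    _ = ∫ t, (3 * b ^ 2 * (g t * φ.normed μ (x - t)) - 2 * b ^ 3 * φ.normed μ (x - t)) ∂μ := by
      rw [integral_sub hg' hk, integral_const_mul, integral_const_mul, integral_normed_sub,
        ← mollify_apply]
    _ ≤ ∫ t, g t ^ 3 * φ.normed μ (x - t) ∂μ := by
      refine integral_mono (hg'.sub hk) (integrable_mul_normed_sub φ hg3 x) fun t => ?_
      -- The graph of `s ↦ s³` on `[0, ∞)` lies above its tangent at `b`.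
      have htangent : 3 * b ^ 2 * g t - 2 * b ^ 3 ≤ g t ^ 3 := by
        linear_combination mul_nonneg (sq_nonneg (g t - b)) (by linarith [h0 t] : 0 ≤ g t + 2 * b)
      calc 3 * b ^ 2 * (g t * φ.normed μ (x - t)) - 2 * b ^ 3 * φ.normed μ (x - t)
          = (3 * b ^ 2 * g t - 2 * b ^ 3) * φ.normed μ (x - t) := by ring
        _ ≤ g t ^ 3 * φ.normed μ (x - t) := by gcongr; exact φ.nonneg_normed _

variable (E) in
/-- Bump functions at the origin with supports of radius `1 / (n + 1)`, used as the kernels of an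
approximate identity. -/
noncomputable def shrinkingBump (n : ℕ) : ContDiffBump (0 : E) where
  rIn := 1 / (n + 1) / 2
  rOut := 1 / (n + 1)
  rIn_pos := by positivity
  rIn_lt_rOut := half_lt_self (by positivity)

theorem ae_tendsto_mollify_shrinkingBump (hg : LocallyIntegrable g μ) :
    ∀ᵐ x ∂μ, Tendsto (fun n => mollify (shrinkingBump E n) μ g x) atTop (𝓝 (g x)) := by
  have hswap : ∀ n, mollify (shrinkingBump E n) μ g =
      (shrinkingBump E n).normed μ ⋆[ContinuousLinearMap.lsmul ℝ ℝ, μ] g := fun n => by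
    funext x
    simp_rw [convolution_lsmul_swap, mollify_apply, smul_eq_mul, mul_comm]
  simp_rw [hswap]
  exact ContDiffBump.ae_convolution_tendsto_right_of_locallyIntegrable (K := 2)
    tendsto_one_div_add_atTop_nhds_zero_nat
    (.of_forall fun n => (mul_div_cancel₀ (1 / (n + 1) : ℝ) two_ne_zero).ge) hg

theorem tendsto_integral_norm_mollify_sub (hg : Integrable g μ) :
    Tendsto (fun n => ∫ x, ‖mollify (shrinkingBump E n) μ g x - g x‖ ∂μ) atTop (𝓝 0) :=
  tendsto_integral_norm_sub_of_integral_norm_le (fun _ => integrable_mollify _ hg) hg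
    (ae_tendsto_mollify_shrinkingBump hg.locallyIntegrable) fun _ => integral_norm_mollify_le _ hg

theorem tendsto_setIntegral_norm_mollify_sub (hg : LocallyIntegrable g μ) {K : Set E}
    (hK : IsCompact K) :
    Tendsto (fun n => ∫ x in K, ‖mollify (shrinkingBump E n) μ g x - g x‖ ∂μ) atTop (𝓝 0) := by
  have hKc : IsCompact (Metric.cthickening 1 K) := hK.cthickening
  have hgi : Integrable ((Metric.cthickening 1 K).indicator g) μ :=
    (hg.integrableOn_isCompact hKc).integrable_indicator hKc.measurableSet
  refine squeeze_zero (fun n => integral_nonneg fun x => norm_nonneg _) (fun n => ?_)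
    (tendsto_integral_norm_mollify_sub hgi)
  have hlocal : ∀ x ∈ K, EqOn g ((Metric.cthickening 1 K).indicator g)
      (Metric.ball x (shrinkingBump E n).rOut) := fun x hx t ht =>
    (indicator_of_mem (Metric.mem_cthickening_of_dist_le t x 1 K hx
      ((Metric.mem_ball.1 ht).le.trans (by
        simpa [shrinkingBump] using Nat.cast_inv_le_one (n + 1)))) g).symm
  rw [setIntegral_congr_fun hK.measurableSet fun x hx => ?_]
  · exact setIntegral_le_integral ((integrable_mollify (shrinkingBump E n) hgi).sub hgi).norm
      (.of_forall fun x => norm_nonneg _)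
  · simp only [mollify_congr _ (hlocal x hx),
      hlocal x hx (Metric.mem_ball_self (shrinkingBump E n).rOut_pos)]

theorem tendstoInL1Loc_mollify (hg : LocallyIntegrable g μ) :
    TendstoInL1Loc (fun n => mollify (shrinkingBump E n) μ g) g μ where
  locallyIntegrable n := (contDiff_mollify (shrinkingBump E n) hg).continuous.locallyIntegrable
  locallyIntegrable_limit := hg
  tendsto _ hK := tendsto_setIntegral_norm_mollify_sub hg hK

end Mollification

section DistributionalLaplacian

variable {E : Type*} [NormedAddCommGroup E] [InnerProductSpace ℝ E] [FiniteDimensional ℝ E]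
  [MeasurableSpace E]

/-- `Δu = F` in the sense of distributions, tested against smooth functions of compact support. -/
def HasDistribLaplacian (u F : E → ℝ) (μ : Measure E) : Prop :=
  ∀ φ : E → ℝ, ContDiff ℝ ∞ φ → HasCompactSupport φ → ∫ x, u x * (Δ φ) x ∂μ = ∫ x, F x * φ x ∂μ

/-- `G ≤ Δv` in the sense of distributions, tested against nonnegative smooth functions of compact
support. -/
def LeDistribLaplacian (G v : E → ℝ) (μ : Measure E) : Prop :=
  ∀ φ : E → ℝ, ContDiff ℝ ∞ φ → HasCompactSupport φ → (∀ x, 0 ≤ φ x) →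
    ∫ x, G x * φ x ∂μ ≤ ∫ x, v x * (Δ φ) x ∂μ

variable {μ : Measure E} {u v F G : E → ℝ}

theorem HasDistribLaplacian.neg (h : HasDistribLaplacian u F μ) :
    HasDistribLaplacian (fun x => -u x) (fun x => -F x) μ := fun φ hφ hφc => by
  simp_rw [neg_mul, integral_neg, h φ hφ hφc]

theorem contDiff_normed_sub (φ : ContDiffBump (0 : E)) (x : E) :
    ContDiff ℝ ∞ fun t => φ.normed μ (x - t) :=
  φ.contDiff_normed.comp (contDiff_const.sub contDiff_id)

variable [BorelSpace E]

theorem LeDistribLaplacian.mono {G' : E → ℝ} (h : LeDistribLaplacian G v μ)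
    (hG : LocallyIntegrable G μ) (hG' : LocallyIntegrable G' μ) (hle : ∀ x, G' x ≤ G x) :
    LeDistribLaplacian G' v μ := fun φ hφ hφc hφ0 =>
  (integral_mono (integrable_mul_of_hasCompactSupport hG' hφ.continuous hφc)
    (integrable_mul_of_hasCompactSupport hG hφ.continuous hφc)
    fun x => mul_le_mul_of_nonneg_right (hle x) (hφ0 x)).trans (h φ hφ hφc hφ0)

theorem LeDistribLaplacian.of_tendsto {G v : E → ℝ} {Gs vs : ℕ → E → ℝ}
    (h : ∀ n, LeDistribLaplacian (Gs n) (vs n) μ) (hG : TendstoInL1Loc Gs G μ)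
    (hv : TendstoInL1Loc vs v μ) : LeDistribLaplacian G v μ := fun φ hφ hφc hφ0 =>
  le_of_tendsto_of_tendsto' (hG.tendsto_integral_mul hφ.continuous hφc)
    (hv.tendsto_integral_mul (continuous_laplacian (contDiff_infty.1 hφ 2))
      (hasCompactSupport_laplacian hφc)) fun n => h n φ hφ hφc hφ0

variable [μ.IsAddHaarMeasure] (φ : ContDiffBump (0 : E))

theorem hasCompactSupport_normed_sub (x : E) :
    HasCompactSupport fun t => φ.normed μ (x - t) :=
  φ.hasCompactSupport_normed.comp_homeomorph (Homeomorph.subLeft x)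

theorem laplacian_mollify_apply (hu : LocallyIntegrable u μ) (x : E) :
    (Δ (mollify φ μ u)) x = ∫ t, u t * (Δ fun y => φ.normed μ (x - y)) t ∂μ := by
  simp_rw [laplacian_comp_const_sub (φ.contDiff_normed (n := 2))]
  exact laplacian_convolution hu (φ.contDiff_normed (n := 2)) φ.hasCompactSupport_normed x

theorem HasDistribLaplacian.laplacian_mollify (h : HasDistribLaplacian u F μ)
    (hu : LocallyIntegrable u μ) : Δ (mollify φ μ u) = mollify φ μ F := by
  funext x
  rw [laplacian_mollify_apply φ hu, mollify_apply]
  exact h _ (contDiff_normed_sub φ x) (hasCompactSupport_normed_sub φ x)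

theorem LeDistribLaplacian.mollify_le (h : LeDistribLaplacian G v μ)
    (hv : LocallyIntegrable v μ) (x : E) : mollify φ μ G x ≤ (Δ (mollify φ μ v)) x := by
  rw [laplacian_mollify_apply φ hv, mollify_apply]
  exact h _ (contDiff_normed_sub φ x) (hasCompactSupport_normed_sub φ x)
    fun t => φ.nonneg_normed _

theorem leDistribLaplacian_comp_of_contDiff {Φ : ℝ → ℝ} (hΦ : ContDiff ℝ 2 Φ)
    (hconv : ConvexOn ℝ univ Φ) (hu : ContDiff ℝ 2 u) :
    LeDistribLaplacian (fun x => deriv Φ (u x) * (Δ u) x) (fun x => Φ (u x)) μ := by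
  intro φ hφ hφc hφ0
  have hcomp : ContDiff ℝ 2 fun x => Φ (u x) := hΦ.comp hu
  have hderiv : Continuous fun x => deriv Φ (u x) :=
    (hΦ.continuous_deriv one_le_two).comp hu.continuous
  rw [integral_mul_laplacian hcomp (contDiff_infty.1 hφ 2) hφc]
  refine integral_mono
    (integrable_mul_of_hasCompactSupport (hderiv.mul (continuous_laplacian hu)).locallyIntegrable
      hφ.continuous hφc)
    (integrable_mul_of_hasCompactSupport (continuous_laplacian hcomp).locallyIntegrable
      hφ.continuous hφc) fun x => ?_
  exact mul_le_mul_of_nonneg_right (deriv_mul_laplacian_le_laplacian_comp hΦ hconv hu x) (hφ0 x)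

/-- Kato's inequality for convex functions of bounded slope. -/
theorem HasDistribLaplacian.leDistribLaplacian_comp (h : HasDistribLaplacian u F μ)
    (hu : LocallyIntegrable u μ) (hF : LocallyIntegrable F μ) {Φ : ℝ → ℝ} {K : NNReal}
    (hΦ : ContDiff ℝ 2 Φ) (hconv : ConvexOn ℝ univ Φ) (hlip : LipschitzWith K Φ) :
    LeDistribLaplacian (fun x => deriv Φ (u x) * F x) (fun x => Φ (u x)) μ := by
  have hderiv : Continuous (deriv Φ) := hΦ.continuous_deriv one_le_two
  refine .of_tendsto (fun n => ?_)
    ((tendstoInL1Loc_mollify hF).bdd_mul (C := K)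
      (b := fun n x => deriv Φ (mollify (shrinkingBump E n) μ u x))
      (fun n => (hderiv.comp (contDiff_mollify _ hu).continuous).aestronglyMeasurable)
      (fun n x => norm_deriv_le_of_lipschitz hlip) ?_)
    ((tendstoInL1Loc_mollify hu).lipschitzWith_comp hlip)
  · rw [← h.laplacian_mollify _ hu]
    exact leDistribLaplacian_comp_of_contDiff hΦ hconv (contDiff_mollify _ hu)
  · filter_upwards [ae_tendsto_mollify_shrinkingBump hu] with x hx
    exact (hderiv.tendsto _).comp hx

theorem LeDistribLaplacian.ae_eq_zero_of_mul_pow_three {c : ℝ}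
    (h : LeDistribLaplacian (fun x => c * v x ^ 3) v μ) (hc : 0 < c) (hv0 : ∀ x, 0 ≤ v x)
    (hv : LocallyIntegrable v μ) (hv3 : LocallyIntegrable (fun x => v x ^ 3) μ) :
    v =ᵐ[μ] 0 := by
  have hΔ : ∀ (φ : ContDiffBump (0 : E)) (x : E),
      c * mollify φ μ v x ^ 3 ≤ (Δ (mollify φ μ v)) x := fun φ x =>
    calc c * mollify φ μ v x ^ 3
        ≤ c * mollify φ μ (fun t => v t ^ 3) x := by
          gcongr
          exact mollify_pow_three_le φ hv0 hv hv3 x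
      _ = mollify φ μ (fun t => c * v t ^ 3) x := by
          simp_rw [mollify_apply, mul_assoc, integral_const_mul]
      _ ≤ (Δ (mollify φ μ v)) x := h.mollify_le φ hv x
  have hzero : ∀ (φ : ContDiffBump (0 : E)) (x : E), mollify φ μ v x = 0 := fun φ x =>
    eq_zero_of_mul_pow_three_le_laplacian (contDiff_mollify φ hv) hc (mollify_nonneg φ hv0 x) (hΔ φ)
  filter_upwards [ae_tendsto_mollify_shrinkingBump hv] with x hx
  simp_rw [hzero] at hx
  exact tendsto_nhds_unique hx tendsto_const_nhds

end DistributionalLaplacian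

section SoftPositivePart

theorem hasDerivAt_comp_max_zero {h : ℝ → ℝ} (hh : Differentiable ℝ h) (h0 : deriv h 0 = 0)
    (s : ℝ) : HasDerivAt (fun t => h (max t 0)) (deriv h (max s 0)) s := by
  have hleft : ∀ t ≤ 0, HasDerivWithinAt (fun t => h (max t 0)) 0 (Iic 0) t := fun t ht =>
    (hasDerivWithinAt_const t (Iic 0) (h 0)).congr (fun x hx => by rw [max_eq_right hx])
      (by rw [max_eq_right ht])
  have hright : ∀ t ≥ 0, HasDerivWithinAt (fun t => h (max t 0)) (deriv h t) (Ici 0) t :=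
    fun t ht => (hh t).hasDerivAt.hasDerivWithinAt.congr (fun x hx => by rw [max_eq_left hx])
      (by rw [max_eq_left ht])
  rcases lt_trichotomy s 0 with hs | rfl | hs
  · rw [max_eq_right hs.le, h0]
    exact (hleft s hs.le).hasDerivAt (Iic_mem_nhds hs)
  · rw [max_self, h0, ← hasDerivWithinAt_univ, ← Iic_union_Ici (a := (0 : ℝ))]
    exact (hleft 0 le_rfl).union (by simpa only [h0] using hright 0 le_rfl)
  · rw [max_eq_left hs.le]
    exact (hright s hs.le).hasDerivAt (Ici_mem_nhds hs)

theorem contDiff_one_comp_max_zero {h : ℝ → ℝ} (hh : ContDiff ℝ 1 h) (h0 : deriv h 0 = 0) :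
    ContDiff ℝ 1 fun t => h (max t 0) := by
  have hderiv := hasDerivAt_comp_max_zero (hh.differentiable one_ne_zero) h0
  refine contDiff_one_iff_deriv.2 ⟨fun s => (hderiv s).differentiableAt, ?_⟩
  rw [funext fun s => (hderiv s).deriv]
  exact hh.continuous_deriv_one.comp (by fun_prop)

/-- A convex `C²` substitute for the positive part of a real number, smooth enough for Kato's
inequality. -/
noncomputable def softPos (s : ℝ) : ℝ := max s 0 - Real.arctan (max s 0)

theorem hasDerivAt_softPos (s : ℝ) :
    HasDerivAt softPos (max s 0 ^ 2 / (1 + max s 0 ^ 2)) s := by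
  have h : ∀ t : ℝ, HasDerivAt (fun t => t - Real.arctan t) (t ^ 2 / (1 + t ^ 2)) t := fun t =>
    ((hasDerivAt_id t).sub (Real.hasDerivAt_arctan t)).congr_deriv (by field_simp; ring)
  rw [← (h (max s 0)).deriv]
  exact hasDerivAt_comp_max_zero (fun t => (h t).differentiableAt) (by simp [(h 0).deriv]) s

theorem deriv_softPos (s : ℝ) : deriv softPos s = max s 0 ^ 2 / (1 + max s 0 ^ 2) :=
  (hasDerivAt_softPos s).deriv

theorem contDiff_softPos : ContDiff ℝ 2 softPos := by
  have hne : ∀ t : ℝ, 1 + t ^ 2 ≠ 0 := fun t => by positivity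
  have h0 : HasDerivAt (fun t : ℝ => t ^ 2 / (1 + t ^ 2)) 0 0 :=
    ((hasDerivAt_pow 2 (0 : ℝ)).fun_div ((hasDerivAt_pow 2 (0 : ℝ)).const_add 1)
      (hne 0)).congr_deriv (by simp)
  rw [← one_add_one_eq_two, contDiff_succ_iff_deriv, funext deriv_softPos]
  refine ⟨fun s => (hasDerivAt_softPos s).differentiableAt, by simp, ?_⟩
  exact contDiff_one_comp_max_zero (h := fun t => t ^ 2 / (1 + t ^ 2))
    ((contDiff_id.pow 2).div (contDiff_const.add (contDiff_id.pow 2)) hne) h0.deriv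

theorem deriv_softPos_nonneg (s : ℝ) : 0 ≤ deriv softPos s := by
  rw [deriv_softPos]
  positivity

theorem deriv_softPos_le_one (s : ℝ) : deriv softPos s ≤ 1 := by
  rw [deriv_softPos, div_le_one (by positivity)]
  exact le_add_of_nonneg_left zero_le_one

theorem deriv_softPos_pos {s : ℝ} (hs : 0 < s) : 0 < deriv softPos s := by
  rw [deriv_softPos, max_eq_left hs.le]
  positivity

theorem monotone_deriv_softPos : Monotone (deriv softPos) := by
  intro s t hst
  have hmax : max s 0 ^ 2 ≤ max t 0 ^ 2 := by gcongr
  rw [deriv_softPos, deriv_softPos, div_le_div_iff₀ (by positivity) (by positivity)]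
  linear_combination hmax

theorem convexOn_softPos : ConvexOn ℝ univ softPos :=
  monotone_deriv_softPos.convexOn_univ_of_deriv (contDiff_softPos.differentiable two_ne_zero)

theorem lipschitzWith_softPos : LipschitzWith 1 softPos :=
  lipschitzWith_of_nnnorm_deriv_le (contDiff_softPos.differentiable two_ne_zero) fun s => by
    rw [← NNReal.coe_le_coe, coe_nnnorm, Real.norm_of_nonneg (deriv_softPos_nonneg s)]
    exact deriv_softPos_le_one s

theorem softPos_of_nonpos {s : ℝ} (hs : s ≤ 0) : softPos s = 0 := by
  simp [softPos, max_eq_right hs]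

theorem softPos_pos {s : ℝ} (hs : 0 < s) : 0 < softPos s := by
  have hmono : StrictMonoOn softPos (Ici 0) :=
    strictMonoOn_of_deriv_pos (convex_Ici 0) contDiff_softPos.continuous.continuousOn fun t ht =>
      deriv_softPos_pos (by simpa using ht)
  simpa only [softPos_of_nonpos le_rfl] using hmono self_mem_Ici hs.le hs

theorem softPos_nonneg (s : ℝ) : 0 ≤ softPos s :=
  (le_or_gt s 0).elim (fun hs => (softPos_of_nonpos hs).ge) fun hs => (softPos_pos hs).le

theorem softPos_le_mul_deriv {s : ℝ} (hs : 0 < s) : softPos s ≤ s * deriv softPos s := by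
  have h := convexOn_softPos.slope_le_deriv (mem_univ 0) (mem_univ s) hs
    (contDiff_softPos.differentiable two_ne_zero s)
  rwa [slope_def_field, softPos_of_nonpos le_rfl, sub_zero, sub_zero, div_le_iff₀ hs, mul_comm] at h

theorem mul_softPos_pow_three_le {c s F : ℝ} (hc : 0 ≤ c) (h : 0 ≤ s → c * s ^ 3 ≤ F) :
    c * softPos s ^ 3 ≤ deriv softPos s * F := by
  rcases le_or_gt s 0 with hs | hs
  · simp [softPos_of_nonpos hs, deriv_softPos, max_eq_right hs]
  · have h0 := deriv_softPos_nonneg s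
    calc c * softPos s ^ 3 ≤ c * (s * deriv softPos s) ^ 3 := by
          gcongr
          exacts [softPos_nonneg s, softPos_le_mul_deriv hs]
      _ = deriv softPos s ^ 3 * (c * s ^ 3) := by ring
      _ ≤ deriv softPos s * F := by
          gcongr
          exacts [pow_le_of_le_one h0 (deriv_softPos_le_one s) three_ne_zero, h hs.le]

end SoftPositivePart

section Comparison

variable {E : Type*} [NormedAddCommGroup E] [InnerProductSpace ℝ E] [FiniteDimensional ℝ E]
  [MeasurableSpace E] [BorelSpace E] {μ : Measure E} [μ.IsAddHaarMeasure]

theorem HasDistribLaplacian.ae_le_of_mul_sub_pow_three_le {u F : E → ℝ} {c z : ℝ}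
    (h : HasDistribLaplacian u F μ) (hu : LocallyIntegrable u μ) (hF : LocallyIntegrable F μ)
    (hc : 0 < c) (hFu : ∀ x, z ≤ u x → c * (u x - z) ^ 3 ≤ F x) : ∀ᵐ x ∂μ, u x ≤ z := by
  set Φ : ℝ → ℝ := fun t => softPos (t - z)
  have hΦ : ContDiff ℝ 2 Φ := contDiff_softPos.comp (contDiff_id.sub contDiff_const)
  have hconv : ConvexOn ℝ univ Φ := by
    simpa [Φ, sub_eq_add_neg, Function.comp_def] using! convexOn_softPos.translate_left (-z)
  have hlip : LipschitzWith 1 Φ := by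
    simpa using! lipschitzWith_softPos.comp (LipschitzWith.id.sub (LipschitzWith.const z))
  have hderiv : ∀ t, deriv Φ t = deriv softPos (t - z) := deriv_comp_sub_const _ _
  have hΦF : LocallyIntegrable (fun x => deriv Φ (u x) * F x) μ :=
    locallyIntegrable_mul_of_norm_le hF
      ((hΦ.continuous_deriv one_le_two).comp_aestronglyMeasurable hu.aestronglyMeasurable)
      (.of_forall fun x => norm_deriv_le_of_lipschitz hlip)
  have hv : LocallyIntegrable (fun x => Φ (u x)) μ :=
    locallyIntegrable_comp_of_lipschitzWith hlip hu
  have hle : ∀ x, c * Φ (u x) ^ 3 ≤ deriv Φ (u x) * F x := fun x => by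
    rw [hderiv]
    exact mul_softPos_pow_three_le hc.le fun hx => hFu x (sub_nonneg.1 hx)
  have hcv3 : LocallyIntegrable (fun x => c * Φ (u x) ^ 3) μ :=
    hΦF.mono ((hv.aestronglyMeasurable.pow 3).const_mul c) (.of_forall fun x => by
      rw [Real.norm_of_nonneg (mul_nonneg hc.le (pow_nonneg (softPos_nonneg _) 3))]
      exact (hle x).trans (Real.le_norm_self _))
  have hv3 : LocallyIntegrable (fun x => Φ (u x) ^ 3) μ := by
    simpa only [Pi.smul_def, smul_eq_mul, inv_mul_cancel_left₀ hc.ne'] using hcv3.smul c⁻¹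
  filter_upwards [((h.leDistribLaplacian_comp hu hF hΦ hconv hlip).mono hΦF hcv3
    hle).ae_eq_zero_of_mul_pow_three hc (fun x => softPos_nonneg _) hv hv3] with x hx
  by_contra! hlt
  exact (softPos_pos (sub_pos.2 hlt)).ne' hx

end Comparison

section CahnHilliard

theorem continuous_cahnHilliardNonlinearity (δ : ℝ) : Continuous (cahnHilliardNonlinearity δ) := by
  unfold cahnHilliardNonlinearity
  fun_prop

theorem cahnHilliardNonlinearity_neg (δ t : ℝ) :
    cahnHilliardNonlinearity (-δ) (-t) = -cahnHilliardNonlinearity δ t := by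
  simp only [cahnHilliardNonlinearity]
  ring

theorem rootSetCH_neg (δ : ℝ) : rootSetCH (-δ) = -rootSetCH δ := by
  ext t
  rw [Set.mem_neg, rootSetCH, rootSetCH, mem_ofPred_eq, mem_ofPred_eq, ← neg_eq_zero,
    ← cahnHilliardNonlinearity_neg, neg_neg]

theorem z₃_neg (δ : ℝ) : z₃ (-δ) = -z₁ δ := by
  rw [z₃, z₁, rootSetCH_neg, Real.sInf_def, neg_neg]

theorem cahnHilliardNonlinearity_lt_zero_of_one_add_abs_lt {δ t : ℝ} (ht : 1 + |δ| < t) :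
    cahnHilliardNonlinearity δ t < 0 := by
  have hδ : 0 ≤ |δ| := abs_nonneg δ
  have hquad : 1 ≤ t * (t + 1) := by nlinarith
  calc cahnHilliardNonlinearity δ t = -(t * (t + 1) * (t - 1)) - δ := by
        rw [cahnHilliardNonlinearity]; ring
    _ ≤ -(1 * (t - 1)) - δ := by gcongr; linarith
    _ < 0 := by linarith [neg_abs_le δ]

theorem exists_mem_rootSetCH_of_nonneg {δ t : ℝ} (ht : 0 ≤ cahnHilliardNonlinearity δ t) :
    ∃ r ∈ rootSetCH δ, t ≤ r := by
  have hneg := cahnHilliardNonlinearity_lt_zero_of_one_add_abs_lt (lt_max_of_lt_right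
    (lt_add_one (1 + |δ|)) : 1 + |δ| < max t (1 + |δ| + 1))
  obtain ⟨r, hr, hroot⟩ := intermediate_value_Icc' (le_max_left t _)
    (continuous_cahnHilliardNonlinearity δ).continuousOn ⟨hneg.le, ht⟩
  exact ⟨r, hroot, hr.1⟩

theorem rootSetCH_nonempty (δ : ℝ) : (rootSetCH δ).Nonempty := by
  have hneg := cahnHilliardNonlinearity_lt_zero_of_one_add_abs_lt (lt_add_one (1 + |-δ|))
  rw [← neg_pos, ← cahnHilliardNonlinearity_neg, neg_neg] at hneg
  obtain ⟨r, hr, -⟩ := exists_mem_rootSetCH_of_nonneg hneg.le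
  exact ⟨r, hr⟩

theorem isGreatest_z₃ (δ : ℝ) : IsGreatest (rootSetCH δ) (z₃ δ) := by
  refine (isClosed_singleton.preimage (continuous_cahnHilliardNonlinearity δ)).isGreatest_csSup
    (rootSetCH_nonempty δ) ⟨1 + |δ|, fun t ht => ?_⟩
  by_contra! hlt
  exact (cahnHilliardNonlinearity_lt_zero_of_one_add_abs_lt hlt).ne ht

theorem cahnHilliardNonlinearity_lt_zero_of_z₃_lt {δ t : ℝ} (ht : z₃ δ < t) :
    cahnHilliardNonlinearity δ t < 0 := by
  by_contra! h
  obtain ⟨r, hr, htr⟩ := exists_mem_rootSetCH_of_nonneg h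
  exact ((isGreatest_z₃ δ).2 hr).not_gt (ht.trans_le htr)

theorem exists_mul_sq_le_quadratic {a b : ℝ} (h : ∀ s > 0, 0 < s ^ 2 + b * s + a) :
    ∃ c > 0, ∀ s ≥ 0, c * s ^ 2 ≤ s ^ 2 + b * s + a := by
  rcases le_or_gt 0 b with hb | hb
  · have hcont : Continuous fun s => s ^ 2 + b * s + a := by fun_prop
    have ha : 0 ≤ a := by
      simpa using ge_of_tendsto (hcont.continuousWithinAt (s := Ioi 0) (x := 0)).tendsto
        (eventually_mem_nhdsWithin.mono fun s hs => (h s hs).le)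
    exact ⟨1, one_pos, fun s hs => by linarith [mul_nonneg hb hs]⟩
  · have hdisc : b ^ 2 < 4 * a := by linarith [h (-b / 2) (by linarith)]
    have ha : 0 < 4 * a := (sq_nonneg b).trans_lt hdisc
    refine ⟨(4 * a - b ^ 2) / (4 * a), div_pos (sub_pos.2 hdisc) ha, fun s _ => ?_⟩
    rw [div_mul_eq_mul_div, div_le_iff₀ ha]
    linear_combination sq_nonneg (b * s + 2 * a)

theorem exists_mul_sub_z₃_pow_three_le (δ : ℝ) :
    ∃ c > 0, ∀ t ≥ z₃ δ, c * (t - z₃ δ) ^ 3 ≤ -cahnHilliardNonlinearity δ t := by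
  have hfactor : ∀ s, -cahnHilliardNonlinearity δ (z₃ δ + s) =
      s * (s ^ 2 + 3 * z₃ δ * s + (3 * z₃ δ ^ 2 - 1)) := fun s => by
    have hroot : cahnHilliardNonlinearity δ (z₃ δ) = 0 := (isGreatest_z₃ δ).1
    simp only [cahnHilliardNonlinearity] at hroot ⊢
    linear_combination -hroot
  obtain ⟨c, hc, hle⟩ := exists_mul_sq_le_quadratic fun s hs => pos_of_mul_pos_right
    ((neg_pos.2 (cahnHilliardNonlinearity_lt_zero_of_z₃_lt (lt_add_of_pos_right _ hs))).trans_eq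
      (hfactor s)) hs.le
  refine ⟨c, hc, fun t ht => ?_⟩
  have hs : 0 ≤ t - z₃ δ := sub_nonneg.2 ht
  calc c * (t - z₃ δ) ^ 3 = (t - z₃ δ) * (c * (t - z₃ δ) ^ 2) := by ring
    _ ≤ (t - z₃ δ) * ((t - z₃ δ) ^ 2 + 3 * z₃ δ * (t - z₃ δ) + (3 * z₃ δ ^ 2 - 1)) := by
      gcongr
      exact hle _ hs
    _ = -cahnHilliardNonlinearity δ t := by rw [← hfactor, add_sub_cancel]

theorem MemLpLoc.locallyIntegrable_pow {N k m : ℕ} {u : EuclideanSpace ℝ (Fin N) → ℝ}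
    (hk : k ≤ m) (hu : MemLpLoc u m) : LocallyIntegrable fun x => u x ^ k := by
  refine locallyIntegrable_iff.2 fun K hK => ?_
  have : IsFiniteMeasure (volume.restrict K) := isFiniteMeasure_restrict.2 hK.measure_ne_top
  have hmem : MemLp u k (volume.restrict K) := (hu K hK).mono_exponent (by exact_mod_cast hk)
  exact hmem.integrable_norm_pow'.mono (hmem.aestronglyMeasurable.pow k)
    (.of_forall fun x => by simp)

theorem MemLpLoc.neg {N : ℕ} {u : EuclideanSpace ℝ (Fin N) → ℝ} {p : ENNReal}
    (hu : MemLpLoc u p) : MemLpLoc (fun x => -u x) p := fun K hK => (hu K hK).neg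

theorem isDistributionalSolution_iff_hasDistribLaplacian {N : ℕ} {δ : ℝ}
    {u : EuclideanSpace ℝ (Fin N) → ℝ} :
    IsDistributionalSolution δ u ↔
      HasDistribLaplacian u (fun x => -cahnHilliardNonlinearity δ (u x)) volume :=
  forall₃_congr fun φ _ _ => by simp_rw [neg_mul, integral_neg, neg_eq_iff_eq_neg]

theorem ae_le_z₃ {N : ℕ} {δ : ℝ} {u : EuclideanSpace ℝ (Fin N) → ℝ} (hu : MemLpLoc u 3)
    (hsol : IsDistributionalSolution δ u) : ∀ᵐ x, u x ≤ z₃ δ := by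
  have hu1 : LocallyIntegrable u := by
    simpa only [pow_one] using hu.locallyIntegrable_pow (k := 1) (m := 3) (by norm_num)
  have hu3 : LocallyIntegrable fun x => u x ^ 3 :=
    hu.locallyIntegrable_pow (m := 3) le_rfl
  have hF : LocallyIntegrable fun x => -cahnHilliardNonlinearity δ (u x) :=
    ((hu1.sub hu3).sub (locallyIntegrable_const δ)).neg
  obtain ⟨c, hc, hle⟩ := exists_mul_sub_z₃_pow_three_le δ
  exact (isDistributionalSolution_iff_hasDistribLaplacian.1 hsol).ae_le_of_mul_sub_pow_three_le
    hu1 hF hc fun x hx => hle (u x) hx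

theorem IsDistributionalSolution.neg {N : ℕ} {δ : ℝ} {u : EuclideanSpace ℝ (Fin N) → ℝ}
    (hsol : IsDistributionalSolution δ u) : IsDistributionalSolution (-δ) fun x => -u x := by
  simp_rw [isDistributionalSolution_iff_hasDistribLaplacian, cahnHilliardNonlinearity_neg] at *
  exact hsol.neg

end CahnHilliard

end

theorem proposition2p1_general (N : ℕ) (δ : ℝ) (u : EuclideanSpace ℝ (Fin N) → ℝ)
    (hu : MemLpLoc u 3) (hsol : IsDistributionalSolution δ u) :
    ∀ᵐ x, z₁ δ ≤ u x ∧ u x ≤ z₃ δ := by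
  have hlower : ∀ᵐ x, -u x ≤ z₃ (-δ) := ae_le_z₃ hu.neg hsol.neg
  filter_upwards [hlower, ae_le_z₃ hu hsol] with x hx₁ hx₃
  rw [z₃_neg] at hx₁
  exact ⟨neg_le_neg_iff.1 hx₁, hx₃⟩

theorem proposition2p1 (N : ℕ) (δ : ℝ) (hδ : δ ∈ Set.Ioo (-(2 / (3 * √3))) (2 / (3 * √3)))
    (u : EuclideanSpace ℝ (Fin N) → ℝ) (hu : MemLpLoc u 3)
    (hsol : IsDistributionalSolution δ u) :
    ∀ᵐ x, z₁ δ ≤ u x ∧ u x ≤ z₃ δ :=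
  proposition2p1_general N δ u hu hsol
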